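/- Let $\mathbf k$ be an algebraically closed field of characteristic $2$, let $V$ be a finite-dimensional $\mathbf k$-vector space with a non-degenerate symplectic (alternating bilinear) form $\langle\,,\rangle$, and let $N\in\mathrm{End}(V)$ be nilpotent with $1+N\in Sp(\langle\,,\rangle)$, i.e. $\langle Nx,y\rangle+\langle x,Ny\rangle+\langle Nx,Ny\rangle=0$ for all $x,y\in V$. For $a\in\mathbf Z$ let $$V_{\ge a}=V^N_{\ge a}=\sum_{j\ge \max(0,a)}N^j(\ker N^{2j-a+1});$$ these subspaces form a filtration $V_*$ of $V$. Let $E^{\langle,\rangle}_{\ge1}V_*$ be the set of all nilpotent $T\in\mathrm{End}(V)$ such that $T(V_{\ge a})\subset V_{\ge a+1}$ for all $a\in\mathbf Z$ and $1+T\in Sp(\langle\,,\rangle)$; it is a group under $T*T'=T+T'+TT'$, and $T\mapsto 1+T$ identifies it with a subgroup $G_1$ of $Sp(\langle\,,\rangle)$. For $u=1+N$ let $A^1(u)=Z_{G_1}(u)/Z_{G_1}(u)^0$, where $Z_{G_1}(u)=\{g\in G_1: gu=ug\}$ and $Z_{G_1}(u)^0$ is its identity component in the Zariski topology. Assume that $\langle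 x,Nx\rangle=0$ for all $x\in V_{\ge-1}$. Then $\{g\in E^{\langle,\rangle}_{\ge1}V_*: gN=Ng\}$ is connected (in the Zariski topology). Hence $A^1(1+N)=\{1\}$. -/

import Mathlib

noncomputable section

namespace SympUnip

/-! ## The Zariski topology on a finite-dimensional vector space -/

section Zariski

/-- The algebra of polynomial functions `E → k` on a vector space `E`: the subalgebra of all
functions generated by the linear functionals. -/
def polyFun (k E : Type*) [Field k] [AddCommGroup E] [Module k E] : Subalgebra k (E → k) :=
  Algebra.adjoin k (Set.range fun φ : Module.Dual k E => (φ : E → k))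

/-- The Zariski topology on a finite-dimensional vector space `E`, viewed as an affine space over
`k`: the closed sets are the sets of common zeros of families of polynomial functions. -/
abbrev zariski (k E : Type*) [Field k] [AddCommGroup E] [Module k E] : TopologicalSpace E :=
  TopologicalSpace.ofClosed
    {S | ∃ I : Set (E → k), I ⊆ (polyFun k E : Set (E → k)) ∧ S = {x | ∀ f ∈ I, f x = 0}}
    (by
      refine ⟨{1}, ?_, ?_⟩
      · rintro f rfl
        exact (polyFun k E).one_mem
      · ext x
        simp)
    (by
      intro A hA
      refine ⟨{f | f ∈ polyFun k E ∧ ∃ S ∈ A, ∀ x ∈ S, f x = 0}, fun f hf => hf.1, ?_⟩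
      ext x
      constructor
      · rintro hx f ⟨-, S, hS, hf⟩
        exact hf x (hx S hS)
      · intro hx S hS
        obtain ⟨I, hI, rfl⟩ := hA hS
        intro f hf
        exact hx f ⟨hI hf, _, hS, fun y hy => hy f hf⟩)
    (by
      rintro S ⟨I, hI, rfl⟩ T ⟨J, hJ, rfl⟩
      refine ⟨{h | ∃ f ∈ I, ∃ g ∈ J, h = f * g}, ?_, ?_⟩
      · rintro h ⟨f, hf, g, hg, rfl⟩
        exact (polyFun k E).mul_mem (hI hf) (hJ hg)
      · ext x
        constructor
        · rintro (hx | hx) h ⟨f, hf, g, hg, rfl⟩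
          · simp [hx f hf]
          · simp [hx g hg]
        · intro hx
          by_contra hcon
          simp only [Set.mem_union, Set.mem_ofPred_eq, not_or, not_forall] at hcon
          obtain ⟨⟨f, hf, hfx⟩, ⟨g, hg, hgx⟩⟩ := hcon
          exact mul_ne_zero hfx hgx (hx (f * g) ⟨f, hf, g, hg, rfl⟩))

/-- A subset of `E` is connected for the Zariski topology. -/
def ZariskiConnected (k : Type*) {E : Type*} [Field k] [AddCommGroup E] [Module k E]
    (S : Set E) : Prop :=
  @IsConnected E (zariski k E) S

theorem polyFun_comp {k E E' : Type*} [Field k] [AddCommGroup E] [Module k E]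
    [AddCommGroup E'] [Module k E'] (L : E →ₗ[k] E') {f : E' → k} (hf : f ∈ polyFun k E') :
    (fun x => f (L x)) ∈ polyFun k E := by
  induction hf using Algebra.adjoin_induction with
  | mem f hf =>
    obtain ⟨φ, rfl⟩ := hf
    exact Algebra.subset_adjoin ⟨φ.comp L, rfl⟩
  | algebraMap r => exact (polyFun k E).algebraMap_mem r
  | add f g _ _ hf hg => exact (polyFun k E).add_mem hf hg
  | mul f g _ _ hf hg => exact (polyFun k E).mul_mem hf hg

theorem isClosed_zariski_iff {k E : Type*} [Field k] [AddCommGroup E] [Module k E] (S : Set E) :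
    @IsClosed E (zariski k E) S ↔
      ∃ I : Set (E → k), I ⊆ (polyFun k E : Set (E → k)) ∧ S = {x | ∀ f ∈ I, f x = 0} := by
  rw [← @isOpen_compl_iff E S (zariski k E)]
  change Sᶜᶜ ∈ _ ↔ _
  rw [compl_compl]
  rfl

theorem continuous_zariski {k E E' : Type*} [Field k] [AddCommGroup E] [Module k E]
    [AddCommGroup E'] [Module k E'] (L : E →ₗ[k] E') :
    @Continuous E E' (zariski k E) (zariski k E') L := by
  let _ := zariski k E
  let _ := zariski k E'
  rw [continuous_iff_isClosed]
  intro S hS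
  obtain ⟨I, hI, rfl⟩ := (isClosed_zariski_iff S).1 hS
  refine (isClosed_zariski_iff _).2 ⟨{h | ∃ f ∈ I, h = fun x => f (L x)}, ?_, ?_⟩
  · rintro h ⟨f, hf, rfl⟩
    exact polyFun_comp L (hI hf)
  · ext x
    constructor
    · rintro hx h ⟨f, hf, rfl⟩
      exact hx f hf
    · intro hx f hf
      exact hx _ ⟨f, hf, rfl⟩

end Zariski

section Main

variable {k V : Type*} [Field k] [AddCommGroup V] [Module k V]

/-! ## Identity component and component group of a subgroup of `GL(V)` -/

/-- The Zariski topology on a subgroup `H` of `GL(V)`, induced from `End(V)`. -/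
abbrev subgroupZariski (H : Subgroup (Module.End k V)ˣ) : TopologicalSpace H :=
  TopologicalSpace.induced (fun h : H => ((h : (Module.End k V)ˣ) : Module.End k V))
    (zariski k (Module.End k V))

theorem continuous_mul_left_subgroup (H : Subgroup (Module.End k V)ˣ) (g : H) :
    @Continuous H H (subgroupZariski H) (subgroupZariski H) (fun h => g * h) := by
  let _ := zariski k (Module.End k V)
  let _ := subgroupZariski H
  refine continuous_induced_rng.2 ?_
  exact (continuous_zariski
    (LinearMap.mulLeft k ((g : (Module.End k V)ˣ) : Module.End k V))).comp continuous_induced_dom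

theorem continuous_mul_right_subgroup (H : Subgroup (Module.End k V)ˣ) (g : H) :
    @Continuous H H (subgroupZariski H) (subgroupZariski H) (fun h => h * g) := by
  let _ := zariski k (Module.End k V)
  let _ := subgroupZariski H
  refine continuous_induced_rng.2 ?_
  exact (continuous_zariski
    (LinearMap.mulRight k ((g : (Module.End k V)ˣ) : Module.End k V))).comp continuous_induced_dom

/-- If `x, y` lie in the connected component of `1`, so does `x⁻¹ * y`. -/
theorem inv_mul_mem_component (H : Subgroup (Module.End k V)ˣ) {x y : H}
    (hx : x ∈ @connectedComponent H (subgroupZariski H) 1)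
    (hy : y ∈ @connectedComponent H (subgroupZariski H) 1) :
    x⁻¹ * y ∈ @connectedComponent H (subgroupZariski H) 1 := by
  let _ := subgroupZariski H
  have h1 : IsPreconnected ((fun h => x⁻¹ * h) '' connectedComponent (1 : H)) :=
    isPreconnected_connectedComponent.image _ (continuous_mul_left_subgroup H x⁻¹).continuousOn
  exact h1.subset_connectedComponent ⟨x, hx, by simp⟩ ⟨y, hy, rfl⟩

/-- The identity component `H⁰` of a subgroup `H` of `GL(V)`: the connected component of `1` for
the Zariski topology. -/
def identityComponent (H : Subgroup (Module.End k V)ˣ) : Subgroup H where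
  carrier := @connectedComponent H (subgroupZariski H) 1
  one_mem' := @mem_connectedComponent H (subgroupZariski H) 1
  inv_mem' := by
    intro x hx
    simpa using inv_mul_mem_component H hx (@mem_connectedComponent H (subgroupZariski H) 1)
  mul_mem' := by
    intro x y hx hy
    have hx' := inv_mul_mem_component H hx (@mem_connectedComponent H (subgroupZariski H) 1)
    simpa using inv_mul_mem_component H hx' hy

instance identityComponent_normal (H : Subgroup (Module.End k V)ˣ) :
    (identityComponent H).Normal where
  conj_mem := by
    intro x hx g
    let _ := subgroupZariski H
    have hc : Continuous (fun h : H => g * h * g⁻¹) :=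
      (continuous_mul_right_subgroup H g⁻¹).comp (continuous_mul_left_subgroup H g)
    have h1 : IsPreconnected ((fun h => g * h * g⁻¹) '' connectedComponent (1 : H)) :=
      isPreconnected_connectedComponent.image _ hc.continuousOn
    exact h1.subset_connectedComponent ⟨1, mem_connectedComponent, by simp⟩ ⟨x, hx, rfl⟩

/-! ## Filtrations -/

/-- A filtration `(V_{≥ a})_{a ∈ ℤ}` of `V`. -/
structure Filtration (k V : Type*) [Field k] [AddCommGroup V] [Module k V] where
  /-- the subspace `V_{≥ a}` -/
  ge : ℤ → Submodule k V
  antitone : Antitone ge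
  exists_eq_bot : ∃ a, ge a = ⊥
  exists_eq_top : ∃ a, ge a = ⊤

/-- `E_{≥ j} V_*`: the endomorphisms `T` with `T (V_{≥ a}) ⊆ V_{≥ a + j}` for all `a`. -/
def Filtration.endGE (F : Filtration k V) (j : ℤ) : Submodule k (Module.End k V) where
  carrier := {T | ∀ a, ∀ x ∈ F.ge a, T x ∈ F.ge (a + j)}
  zero_mem' := by
    intro a x _
    simp
  add_mem' := by
    intro S T hS hT a x hx
    exact (F.ge (a + j)).add_mem (hS a x hx) (hT a x hx)
  smul_mem' := by
    intro c T hT a x hx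
    exact (F.ge (a + j)).smul_mem c (hT a x hx)

/-- `V^N_{≥ a} = ∑_{j ≥ max(0, a)} N^j (ker N^{2j - a + 1})`.
The exponent `2j - a + 1` is positive for all `j` that occur. -/
def nilFiltrationGE (N : Module.End k V) (a : ℤ) : Submodule k V :=
  ⨆ (j : ℕ) (_ : a ≤ (j : ℤ)),
    (LinearMap.ker (N ^ (2 * (j : ℤ) - a + 1).toNat)).map (N ^ j)

/-- The filtration `V^N_*` of `V` attached to a nilpotent endomorphism `N`. -/
def nilFiltration (N : Module.End k V) (hN : IsNilpotent N) : Filtration k V where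
  ge := nilFiltrationGE N
  antitone := by
    intro a b hab
    refine iSup_le fun j => iSup_le fun hj => ?_
    refine le_trans ?_ (le_iSup_of_le j (le_iSup_of_le (hab.trans hj) le_rfl))
    refine Submodule.map_mono fun x hx => ?_
    rw [LinearMap.mem_ker] at hx ⊢
    obtain ⟨c, hc⟩ := Nat.exists_eq_add_of_le
      (show (2 * (j : ℤ) - b + 1).toNat ≤ (2 * (j : ℤ) - a + 1).toNat by omega)
    rw [hc, add_comm, pow_add, Module.End.mul_apply, hx, map_zero]
  exists_eq_bot := by
    obtain ⟨e, he⟩ := hN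
    refine ⟨e, le_bot_iff.1 (iSup_le fun j => iSup_le fun hj => ?_)⟩
    have h0 : N ^ j = 0 := pow_eq_zero_of_le (by exact_mod_cast hj) he
    rw [h0, Submodule.map_zero]
  exists_eq_top := by
    obtain ⟨e, he⟩ := hN
    refine ⟨-e, top_le_iff.1 ?_⟩
    refine le_iSup_of_le 0 (le_iSup_of_le (by simp) ?_)
    have h0 : N ^ (2 * ((0 : ℕ) : ℤ) - -(e : ℤ) + 1).toNat = 0 :=
      pow_eq_zero_of_le (by omega) he
    rw [h0, LinearMap.ker_zero, pow_zero, Module.End.one_eq_id, Submodule.map_id]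

/-! ## The symplectic group and its subgroups -/

/-- `Sp(ω)`: the elements of `GL(V)` that preserve the bilinear form `ω`. -/
def symplecticGroup (ω : LinearMap.BilinForm k V) : Subgroup (Module.End k V)ˣ where
  carrier := {g | ∀ x y, ω ((g : Module.End k V) x) ((g : Module.End k V) y) = ω x y}
  one_mem' := by
    intro x y
    rfl
  mul_mem' := by
    intro g h hg hh x y
    exact (hg _ _).trans (hh x y)
  inv_mem' := by
    intro g hg x y
    have key : ∀ z, (g : Module.End k V) (((g⁻¹ : (Module.End k V)ˣ) : Module.End k V) z) = z := by
      intro z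
      rw [← Module.End.mul_apply, Units.mul_inv, Module.End.one_apply]
    rw [← hg, key, key]

/-- `M_ω`: the nilpotent `T ∈ End(V)` such that `1 + T` preserves `ω`. -/
def nilSymplectic (ω : LinearMap.BilinForm k V) : Set (Module.End k V) :=
  {T | IsNilpotent T ∧ ∀ x y, ω (T x) y + ω x (T y) + ω (T x) (T y) = 0}

/-- `E^ω_{≥ n} V_* = E_{≥ n} V_* ∩ M_ω`. For `n ≥ 1` and `V_*` self-dual this is a unipotent group
under `T * T' = T + T' + T T'`, identified by `T ↦ 1 + T` with a subgroup of `Sp(ω)`. -/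
def sympEndGE (ω : LinearMap.BilinForm k V) (F : Filtration k V) (n : ℤ) :
    Set (Module.End k V) :=
  (F.endGE n : Set (Module.End k V)) ∩ nilSymplectic ω

theorem nilpotent_of_mem_endGE (F : Filtration k V) {T : Module.End k V} (hT : T ∈ F.endGE 1) :
    IsNilpotent T := by
  obtain ⟨a, ha⟩ := F.exists_eq_top
  obtain ⟨b, hb⟩ := F.exists_eq_bot
  have key : ∀ (m : ℕ) (x : V), (T ^ m) x ∈ F.ge (a + m) := by
    intro m
    induction m with
    | zero =>
      intro x
      simp [ha]
    | succ m ih =>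
      intro x
      rw [pow_succ', Module.End.mul_apply]
      have := hT _ _ (ih x)
      push_cast
      rwa [← add_assoc]
  refine ⟨(b - a).toNat, LinearMap.ext fun x => ?_⟩
  have h1 := F.antitone (show b ≤ a + ((b - a).toNat : ℤ) by omega) (key (b - a).toNat x)
  rw [hb] at h1
  simpa using h1

/-- For a filtration `V_*`, the subgroup `G₁ = 1 + E^ω_{≥ 1} V_*` of `Sp(ω)`
(see `mem_groupOne_iff`). -/
def groupOne (ω : LinearMap.BilinForm k V) (F : Filtration k V) :
    Subgroup (Module.End k V)ˣ where
  carrier := {g | (g : Module.End k V) - 1 ∈ F.endGE 1 ∧ g ∈ symplecticGroup ω}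
  one_mem' := by
    refine ⟨?_, (symplecticGroup ω).one_mem⟩
    rw [Units.val_one, sub_self]
    exact (F.endGE 1).zero_mem
  mul_mem' := by
    rintro g h ⟨hg, hg'⟩ ⟨hh, hh'⟩
    refine ⟨?_, (symplecticGroup ω).mul_mem hg' hh'⟩
    intro a x hx
    have e : ((g * h : (Module.End k V)ˣ) : Module.End k V) - 1
        = ((g : Module.End k V) - 1) * ((h : Module.End k V) - 1)
          + ((g : Module.End k V) - 1) + ((h : Module.End k V) - 1) := by
      rw [Units.val_mul]
      noncomm_ring
    rw [e]
    refine Submodule.add_mem _ (Submodule.add_mem _ ?_ (hg a x hx)) (hh a x hx)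
    exact F.antitone (by omega) (hg _ _ (hh a x hx))
  inv_mem' := by
    rintro g ⟨hg, hg'⟩
    refine ⟨?_, (symplecticGroup ω).inv_mem hg'⟩
    obtain ⟨m, hm⟩ := nilpotent_of_mem_endGE F hg
    -- `(g⁻¹ - 1) = -(g - 1) - (g - 1) (g⁻¹ - 1)`; descend using nilpotency of `g - 1`
    have e : ((g⁻¹ : (Module.End k V)ˣ) : Module.End k V) - 1
        = -((g : Module.End k V) - 1)
          - ((g : Module.End k V) - 1) * (((g⁻¹ : (Module.End k V)ˣ) : Module.End k V) - 1) := by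
      have := Units.mul_inv g
      rw [mul_sub, sub_mul, this]
      noncomm_ring
    have mul_mem : ∀ S T, S ∈ F.endGE 1 → T ∈ F.endGE 1 → S * T ∈ F.endGE 1 := by
      intro S T hS hT a x hx
      exact F.antitone (by omega) (hS _ _ (hT a x hx))
    have key : ∀ i ≤ m, ((g : Module.End k V) - 1) ^ (m - i)
        * (((g⁻¹ : (Module.End k V)ˣ) : Module.End k V) - 1) ∈ F.endGE 1 := by
      intro i
      induction i with
      | zero =>
        intro _
        rw [Nat.sub_zero, hm, zero_mul]
        exact (F.endGE 1).zero_mem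
      | succ i ih =>
        intro hi
        have ih' := ih (by omega)
        rw [e, mul_sub, mul_neg, ← mul_assoc, ← pow_succ,
          show m - (i + 1) + 1 = m - i by omega]
        refine Submodule.sub_mem _ (Submodule.neg_mem _ ?_) ih'
        obtain ⟨c, hc⟩ : ∃ c, m - i = c + 1 := ⟨m - i - 1, by omega⟩
        rw [hc]
        clear hc ih ih' hi
        induction c with
        | zero => simpa using hg
        | succ c ihc =>
          rw [pow_succ]
          exact mul_mem _ _ ihc hg
    simpa using key m le_rfl

theorem mem_symplecticGroup_iff (ω : LinearMap.BilinForm k V) (g : (Module.End k V)ˣ) :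
    g ∈ symplecticGroup ω ↔
      ∀ x y, ω (((g : Module.End k V) - 1) x) y + ω x (((g : Module.End k V) - 1) y)
        + ω (((g : Module.End k V) - 1) x) (((g : Module.End k V) - 1) y) = 0 := by
  refine forall_congr' fun x => forall_congr' fun y => ?_
  simp only [LinearMap.sub_apply, Module.End.one_apply, map_sub]
  constructor
  · intro h
    rw [h]
    ring
  · intro h
    linear_combination h

/-- `G₁ = 1 + E^ω_{≥ 1} V_*`. -/
theorem mem_groupOne_iff (ω : LinearMap.BilinForm k V) (F : Filtration k V)
    (g : (Module.End k V)ˣ) :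
    g ∈ groupOne ω F ↔ (g : Module.End k V) - 1 ∈ sympEndGE ω F 1 := by
  constructor
  · rintro ⟨h1, h2⟩
    exact ⟨h1, nilpotent_of_mem_endGE F h1, (mem_symplecticGroup_iff ω g).1 h2⟩
  · rintro ⟨h1, -, h2⟩
    exact ⟨h1, (mem_symplecticGroup_iff ω g).2 h2⟩

/-! ## The group `A¹(u)` -/

/-- The centralizer `Z_{H}(u)` of `u` in a subgroup `H` of `GL(V)`. -/
def centralizerIn (H : Subgroup (Module.End k V)ˣ) (u : (Module.End k V)ˣ) :
    Subgroup (Module.End k V)ˣ :=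
  H ⊓ Subgroup.centralizer {u}

/-- For a unipotent element `u` of `Sp(ω)`, the group `A¹(u) = Z_{G₁}(u) / Z_{G₁}(u)⁰`. Here
`G₁ = 1 + E^ω_{≥ 1} V_*` for the filtration `V_*` attached to `u`, i.e. the one such that `u` lies
in `1 + {T ∈ M_ω : V^T_* = V_*}`; this is `V_* = V^{u-1}_*`. -/
abbrev AOne (ω : LinearMap.BilinForm k V) (u : symplecticGroup ω)
    (hu : IsNilpotent (((u : (Module.End k V)ˣ) : Module.End k V) - 1)) : Type _ :=
  centralizerIn (groupOne ω (nilFiltration _ hu)) u ⧸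
    identityComponent (centralizerIn (groupOne ω (nilFiltration _ hu)) u)

/-- The element `1 + N` of `Sp(ω)`, for `N ∈ M_ω`. -/
def oneAdd (ω : LinearMap.BilinForm k V) {N : Module.End k V} (hN : N ∈ nilSymplectic ω) :
    symplecticGroup ω :=
  ⟨hN.1.isUnit_one_add.unit, (mem_symplecticGroup_iff ω _).2 (by simpa using hN.2)⟩

theorem coe_oneAdd (ω : LinearMap.BilinForm k V) {N : Module.End k V}
    (hN : N ∈ nilSymplectic ω) :
    (((oneAdd ω hN : symplecticGroup ω) : (Module.End k V)ˣ) : Module.End k V) = 1 + N :=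
  rfl

theorem isNilpotent_oneAdd_sub_one (ω : LinearMap.BilinForm k V) {N : Module.End k V}
    (hN : N ∈ nilSymplectic ω) :
    IsNilpotent
      ((((oneAdd ω hN : symplecticGroup ω) : (Module.End k V)ˣ) : Module.End k V) - 1) := by
  rw [coe_oneAdd, add_sub_cancel_left]
  exact hN.1

end Main

end SympUnip

end

/-! Write `T*` for the adjoint with respect to `ω`. The proof rests on an operator `J` commuting
with `N` such that `J + J* = 1`.

Given `J`, a Cayley-type transform linearizes the group. The element `1 + T` is symplectic exactly
when `T + T* + T* T = 0`, and then `X = T + T* J T` is skew-adjoint. Conversely, if `X* = -X` and `p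
+ p* J p = X`, the adjoint equation is `p* + p* (1 - J) p = -X`, and the sum of the two says that `1
+ p` is symplectic. Inside `E_{≥ 1}` the equation is solved by an iteration that stabilizes after
finitely many steps. Replacing `X` by `s X` therefore gives a polynomial curve in the centralizer
from `0` to `T`, and polynomial curves over an infinite field are irreducible
(`exists_curve_of_add_adjoint_eq_one`, `zariskiConnected_of_curves`).

Finding `J` amounts to writing `ω x y = β x y - β y x` with `β` invariant under `1 + N`, where `β x
y = ω (J x) y`. After decomposing `V` into cyclic `k[N]`-modules, only the diagonal blocks offer
resistance. There `ω` is encoded by a functional `ν` on `k[t]/(t ^ (d + 1))`, and in characteristic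
two the obstruction is its value at the socle, that is `ω x (N ^ d x)` with `N ^ (d + 1) x = 0`
(`exists_sub_comp_eq`). Alternation kills it for even `d`, the hypothesis on `V_{≥ -1}` for odd `d`
(`form_apply_pow_eq_zero`). -/

noncomputable section

namespace SympUnip

/-! ### Polynomial curves and Zariski connectedness -/

section Curves

open Polynomial

variable {k A : Type*} [Field k] [Ring A] [Algebra k A]

/-- Evaluation of a polynomial with coefficients in a `k`-algebra `A` at a scalar. -/
def evalScalar (A : Type*) [Ring A] [Algebra k A] (s : k) : A[X] →+* A :=
  -- Scalars are central, so evaluation is multiplicative even though `A` need not be commutative.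
  eval₂RingHom' (RingHom.id A) (algebraMap k A s) fun a => (Algebra.commutes s a).symm

@[simp]
theorem evalScalar_C (s : k) (a : A) : evalScalar A s (C a) = a := by
  simp [evalScalar, eval₂RingHom']

@[simp]
theorem evalScalar_X (s : k) : evalScalar A s X = algebraMap k A s := by
  simp [evalScalar, eval₂RingHom']

theorem exists_polynomial_dual_evalScalar (P : A[X]) (φ : Module.Dual k A) :
    ∃ p : k[X], ∀ s, φ (evalScalar A s P) = p.eval s := by
  induction P using Polynomial.induction_on' with
  | add P Q hP hQ =>
    obtain ⟨p, hp⟩ := hP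
    obtain ⟨q, hq⟩ := hQ
    exact ⟨p + q, fun s => by simp [hp, hq]⟩
  | monomial n a =>
    refine ⟨C (φ a) * X ^ n, fun s => ?_⟩
    rw [← C_mul_X_pow_eq_monomial, map_mul, map_pow, evalScalar_C, evalScalar_X, ← map_pow,
      ← Algebra.commutes, ← Algebra.smul_def, map_smul]
    rw [eval_mul, eval_C, eval_pow, eval_X, smul_eq_mul, mul_comm]

/-- Restricted to a polynomial curve, Zariski-closed conditions become one-variable polynomial
equations; this yields irreducibility of the curve. -/
theorem exists_polynomial_polyFun_evalScalar (P : A[X]) {f : A → k} (hf : f ∈ polyFun k A) :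
    ∃ p : k[X], ∀ s, f (evalScalar A s P) = p.eval s := by
  induction hf using Algebra.adjoin_induction with
  | mem f hf =>
    obtain ⟨φ, rfl⟩ := hf
    exact exists_polynomial_dual_evalScalar P φ
  | algebraMap r => exact ⟨C r, fun s => by simp⟩
  | add f g _ _ hf hg =>
    obtain ⟨p, hp⟩ := hf
    obtain ⟨q, hq⟩ := hg
    exact ⟨p + q, fun s => by simp [hp, hq]⟩
  | mul f g _ _ hf hg =>
    obtain ⟨p, hp⟩ := hf
    obtain ⟨q, hq⟩ := hg
    exact ⟨p * q, fun s => by simp [hp, hq]⟩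

theorem exists_polyFun_of_isOpen {U : Set A} (hU : @IsOpen A (zariski k A) U) {x : A}
    (hx : x ∈ U) : ∃ f ∈ polyFun k A, f x ≠ 0 ∧ ∀ y, f y ≠ 0 → y ∈ U := by
  let _ := zariski k A
  obtain ⟨I, hI, hUI⟩ := (isClosed_zariski_iff _).1 hU.isClosed_compl
  have hx' : x ∉ Uᶜ := fun h => h hx
  rw [hUI] at hx'
  simp only [Set.mem_ofPred_eq, not_forall] at hx'
  obtain ⟨f, hf, hfx⟩ := hx'
  refine ⟨f, hI hf, hfx, fun y hy => ?_⟩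
  by_contra hyU
  have : y ∈ Uᶜ := hyU
  rw [hUI] at this
  exact hy (this f hf)

/-- A polynomial curve over an infinite field is irreducible. -/
theorem isPreirreducible_range_evalScalar [Infinite k] (P : A[X]) :
    @IsPreirreducible A (zariski k A) (Set.range fun s : k => evalScalar A s P) := by
  let _ := zariski k A
  rintro U W hU hW ⟨_, ⟨s, rfl⟩, hs⟩ ⟨_, ⟨t, rfl⟩, ht⟩
  obtain ⟨f, hf, hfs, hfU⟩ := exists_polyFun_of_isOpen hU hs
  obtain ⟨g, hg, hgt, hgW⟩ := exists_polyFun_of_isOpen hW ht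
  obtain ⟨p, hp⟩ := exists_polynomial_polyFun_evalScalar P hf
  obtain ⟨q, hq⟩ := exists_polynomial_polyFun_evalScalar P hg
  have hpq : p * q ≠ 0 := by
    refine mul_ne_zero ?_ ?_
    · rintro rfl
      exact hfs (by simp [hp])
    · rintro rfl
      exact hgt (by simp [hq])
  obtain ⟨r, hr⟩ : ∃ r, (p * q).eval r ≠ 0 := by
    by_contra! h
    exact hpq (Polynomial.funext fun r => by simp [h r])
  rw [eval_mul] at hr
  refine ⟨_, ⟨r, rfl⟩, hfU _ ?_, hgW _ ?_⟩
  · rw [hp]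
    exact left_ne_zero_of_mul hr
  · rw [hq]
    exact right_ne_zero_of_mul hr

/-- A set all of whose points are joined to a given one by polynomial curves is connected. -/
theorem zariskiConnected_of_curves [Infinite k] {S : Set A} {x : A} (hx : x ∈ S)
    (h : ∀ y ∈ S, ∃ P : A[X], (∀ s : k, evalScalar A s P ∈ S) ∧
      evalScalar A (0 : k) P = x ∧ evalScalar A (1 : k) P = y) :
    ZariskiConnected k S := by
  let _ := zariski k A
  refine ⟨⟨x, hx⟩, isPreconnected_of_forall x fun y hy => ?_⟩
  obtain ⟨P, hP, h0, h1⟩ := h y hy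
  exact ⟨_, Set.range_subset_iff.2 hP, ⟨0, h0⟩, ⟨1, h1⟩,
    (isPreirreducible_range_evalScalar P).isPreconnected⟩

end Curves

/-! ### Antiinvariant functionals on a truncated polynomial algebra -/

section Primitive

open Polynomial

variable {k R : Type*} [Field k] [CharP k 2] [CommRing R] [Algebra k R]

/-- In characteristic two, an antiinvariant functional `ν` on the truncated polynomial algebra
`k[t]/(t ^ (d + 1))`, with involution `1 + t ↦ (1 + t)⁻¹`, is of the form `μ - μ ∘ bar` as soon as
it vanishes at `1` and at the socle. -/
theorem exists_sub_comp_eq {t : R} (ht : Function.Surjective (aeval t : k[X] →ₐ[k] R))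
    {d : ℕ} (hann : ∀ r, t * r = 0 → ∃ c : k, r = c • t ^ d)
    (bar : R →ₐ[k] R) (hbar : (1 + t) * (1 + bar t) = 1) (hbb : bar (bar t) = t)
    (ν : Module.Dual k R) (hν : ∀ r, ν (bar r) = -ν r) (h1 : ν 1 = 0) (hd : ν (t ^ d) = 0) :
    ∃ μ : Module.Dual k R, ∀ r, μ r - μ (bar r) = ν r := by
  have two : ∀ r : R, r + r = 0 := fun r => by
    rw [← two_smul k r, CharTwo.two_eq_zero, zero_smul]
  -- In characteristic two the trace and the norm of `t` coincide. Hence `t` is quadratic over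
  -- `k[z]`, and `k[z]` consists of `bar`-invariants.
  set z := t + bar t with hz
  have hz' : z = t * bar t := by
    linear_combination hbar - two (t * bar t)
  have hzbar : bar z = z := by rw [hz, map_add, hbb, add_comm]
  have ht2 : t * t = z + z * t := by
    linear_combination (-(1 + t)) * hz - hbar
  have hbt : bar t = z + t := by linear_combination -hz - two t
  have hzt : z * (1 + t) = t * t := by rw [ht2]; ring
  have hunit : IsUnit (1 + t) := IsUnit.of_mul_eq_one _ hbar
  have hp : ∀ p : k[X], bar (aeval z p) = aeval z p := fun p => by
    rw [← aeval_algHom_apply, hzbar]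
  have hνp : ∀ p : k[X], ν (aeval z p) = 0 := by
    intro p
    induction p using Polynomial.induction_on' with
    | add p q hp hq => rw [map_add, map_add, hp, hq, add_zero]
    | monomial n a =>
      rw [aeval_monomial, ← Algebra.smul_def, map_smul]
      cases n with
      | zero => simp [h1]
      | succ n =>
        -- Positive powers of `z` are traces, on which an antiinvariant functional vanishes.
        have : z ^ (n + 1) = z ^ n * t + bar (z ^ n * t) := by
          rw [map_mul, map_pow, hzbar, pow_succ]; conv_lhs => rw [hz]
          ring
        rw [this, map_add, hν, add_neg_cancel, smul_zero]
  have hspan : ∀ r : R, ∃ p q : k[X], r = aeval z p + aeval z q * t := by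
    intro r
    obtain ⟨f, rfl⟩ := ht r
    induction f using Polynomial.induction_on with
    | C a => exact ⟨C a, 0, by simp⟩
    | add f g hf hg =>
      obtain ⟨p, q, h⟩ := hf
      obtain ⟨p', q', h'⟩ := hg
      exact ⟨p + p', q + q', by simp only [map_add, h, h']; ring⟩
    | monomial n a hf =>
      obtain ⟨p, q, h⟩ := hf
      refine ⟨q * X, p + q * X, ?_⟩
      rw [pow_succ, ← mul_assoc, map_mul, h, aeval_X]
      simp only [map_add, map_mul, aeval_X]
      linear_combination (aeval z q) * ht2
  -- An invariant `p(z) + q(z) t` has `q(z) z = 0`. As `z` is `t ^ 2` up to a unit, `q(z) t` is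
  -- annihilated by `t`, so it lies in the socle, where `ν` vanishes.
  have hker : LinearMap.ker (LinearMap.id - bar.toLinearMap : R →ₗ[k] R) ≤ LinearMap.ker ν := by
    intro r hr
    rw [LinearMap.mem_ker] at hr ⊢
    obtain ⟨p, q, rfl⟩ := hspan r
    have hr' : aeval z q * z = 0 := by
      simp only [LinearMap.sub_apply, LinearMap.id_apply, AlgHom.toLinearMap_apply, map_add,
        map_mul, hp, hbt] at hr
      linear_combination -hr
    have : t * (aeval z q * t) = 0 := by
      linear_combination (1 + t) * hr' - aeval z q * hzt
    obtain ⟨c, hc⟩ := hann _ this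
    rw [map_add, hνp, hc, map_smul, hd, smul_zero, add_zero]
  -- By duality, a functional killing the kernel of `1 - bar` is in the image of its transpose.
  have : ν ∈ (LinearMap.ker (LinearMap.id - bar.toLinearMap : R →ₗ[k] R)).dualAnnihilator :=
    (Submodule.mem_dualAnnihilator _).2 fun r hr => hker hr
  rw [← LinearMap.range_dualMap_eq_dualAnnihilator_ker] at this
  obtain ⟨μ, hμ⟩ := this
  refine ⟨μ, fun r => ?_⟩
  rw [← hμ]
  simp

end Primitive

/-! ### An invariant form whose antisymmetrization is `ω` -/

section Polarization

open Polynomial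

variable {k V : Type*} [Field k] [AddCommGroup V] [Module k V]

/-- A bilinear form is invariant under `u`. -/
def InvariantUnder (β : LinearMap.BilinForm k V) (u : Module.End k V) : Prop :=
  ∀ x y, β (u x) (u y) = β x y

/-- Alternating invariant forms that are antisymmetrizations of invariant forms on each summand of
an invariant decomposition are so globally. -/
theorem exists_invariant_sub_flip_of_sum {ι : Type*} [Fintype ι] [LinearOrder ι]
    {ω : LinearMap.BilinForm k V} (hω : ω.IsAlt) {u : Module.End k V} (hu : InvariantUnder ω u)
    (P : ι → Module.End k V) (hP : ∀ i x, P i (u x) = u (P i x)) (hsum : ∀ x, ∑ i, P i x = x)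
    (h : ∀ i, ∃ β : LinearMap.BilinForm k V, InvariantUnder β u ∧
      ∀ x y, β x y - β y x = ω (P i x) (P i y)) :
    ∃ β : LinearMap.BilinForm k V, InvariantUnder β u ∧ ∀ x y, β x y - β y x = ω x y := by
  choose b hb hb' using h
  -- The summands need not be orthogonal: each cross term of `ω` is put entirely above the diagonal,
  -- and its flip supplies the part below with the right sign.
  let γ : ι → ι → LinearMap.BilinForm k V := fun i j =>
    if i < j then ω.compl₁₂ (P i) (P j) else if i = j then b i else 0
  have hγ : ∀ i j, InvariantUnder (γ i j) u := by
    intro i j x y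
    simp only [γ]
    split_ifs
    · simp only [LinearMap.compl₁₂_apply, hP, hu _ _]
    · exact hb i x y
    · rfl
  have hγ' : ∀ i j x y, γ i j x y - γ j i y x = ω (P i x) (P j y) := by
    intro i j x y
    simp only [γ]
    rcases lt_trichotomy i j with hij | rfl | hij
    · simp [hij, hij.not_gt, hij.ne']
    · simp [hb']
    · simp [hij, hij.not_gt, hij.ne', hω.neg_eq]
  refine ⟨∑ i, ∑ j, γ i j, fun x y => ?_, fun x y => ?_⟩
  · simp only [LinearMap.sum_apply]
    exact Finset.sum_congr rfl fun i _ => Finset.sum_congr rfl fun j _ => hγ i j x y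
  · conv_rhs => rw [← hsum x, ← hsum y]
    simp only [LinearMap.sum_apply, map_sum]
    rw [Finset.sum_comm (f := fun i j => γ i j y x), ← Finset.sum_sub_distrib,
      Finset.sum_comm (f := fun i j => ω (P j x) (P i y))]
    refine Finset.sum_congr rfl fun i _ => ?_
    rw [← Finset.sum_sub_distrib]
    exact Finset.sum_congr rfl fun j _ => hγ' i j x y

/-- The truncated polynomial algebra `k[t]/(t ^ n)`. -/
abbrev Truncated (k : Type*) [Field k] (n : ℕ) : Type _ :=
  k[X] ⧸ Submodule.span k[X] {(X : k[X]) ^ n}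

/-- The generator of the truncated polynomial algebra. -/
def Truncated.gen (k : Type*) [Field k] (n : ℕ) : Truncated k n :=
  Ideal.Quotient.mkₐ k (Submodule.span k[X] {(X : k[X]) ^ n}) X

theorem Truncated.aeval_gen (n : ℕ) (f : k[X]) :
    aeval (Truncated.gen k n) f =
      Ideal.Quotient.mkₐ k (Submodule.span k[X] {(X : k[X]) ^ n}) f := by
  rw [Truncated.gen, aeval_algHom_apply, aeval_X_left_apply]

theorem Truncated.aeval_gen_surjective (n : ℕ) :
    Function.Surjective (aeval (Truncated.gen k n) : k[X] →ₐ[k] Truncated k n) := by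
  intro r
  obtain ⟨f, rfl⟩ := Ideal.Quotient.mkₐ_surjective k _ r
  exact ⟨f, Truncated.aeval_gen n f⟩

theorem Truncated.gen_pow (n : ℕ) : Truncated.gen k n ^ n = 0 := by
  rw [Truncated.gen, ← map_pow, Ideal.Quotient.mkₐ_eq_mk, Ideal.Quotient.eq_zero_iff_mem]
  exact Submodule.mem_span_singleton_self _

theorem Truncated.exists_smul_of_gen_mul_eq_zero (d : ℕ) (r : Truncated k (d + 1))
    (hr : Truncated.gen k (d + 1) * r = 0) : ∃ c : k, r = c • Truncated.gen k (d + 1) ^ d := by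
  obtain ⟨f, rfl⟩ := Truncated.aeval_gen_surjective (d + 1) r
  have h1 : aeval (Truncated.gen k (d + 1)) (X * f) = 0 := by rw [map_mul, aeval_X, hr]
  rw [Truncated.aeval_gen, Ideal.Quotient.mkₐ_eq_mk, Ideal.Quotient.eq_zero_iff_mem] at h1
  obtain ⟨g, hg⟩ := Ideal.mem_span_singleton.1 h1
  have hf : f = X ^ d * g := by
    refine mul_left_cancel₀ (X_ne_zero (R := k)) ?_
    rw [hg]
    ring
  -- Modulo `X ^ (d + 1)`, only the constant term of `g` survives in `X ^ d * g`.
  refine ⟨g.coeff 0, ?_⟩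
  conv_lhs => rw [hf, ← divX_mul_X_add g]
  rw [show (X : k[X]) ^ d * (g.divX * X + C (g.coeff 0))
    = g.divX * X ^ (d + 1) + C (g.coeff 0) * X ^ d by ring]
  rw [map_add, map_mul, map_mul, map_pow, map_pow, aeval_X, aeval_C, Truncated.gen_pow, mul_zero,
    zero_add]
  exact (Algebra.smul_def _ _).symm

/-- The involution `1 + t ↦ (1 + t)⁻¹` of `k[t]/(t ^ n)`. -/
theorem Truncated.exists_involution (n : ℕ) :
    ∃ bar : Truncated k n →ₐ[k] Truncated k n,
      (1 + Truncated.gen k n) * (1 + bar (Truncated.gen k n)) = 1 ∧ ∀ r, bar (bar r) = r := by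
  set t := Truncated.gen k n with ht
  have hnil : IsNilpotent t := ⟨n, Truncated.gen_pow n⟩
  obtain ⟨v, hv⟩ := hnil.isUnit_one_add
  have hvi : (1 + t) * ((v⁻¹ : (Truncated k n)ˣ) : Truncated k n) = 1 := by
    rw [← hv, Units.mul_inv]
  set w : Truncated k n := ((v⁻¹ : (Truncated k n)ˣ) : Truncated k n) with hw
  have hw1 : w - 1 = -w * t := by linear_combination hvi
  let bar : Truncated k n →ₐ[k] Truncated k n :=
    Ideal.Quotient.liftₐ (Submodule.span k[X] {(X : k[X]) ^ n}) (aeval (w - 1)) (by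
      intro a ha
      obtain ⟨g, rfl⟩ := Ideal.mem_span_singleton.1 ha
      rw [map_mul, map_pow, aeval_X, hw1, mul_pow, Truncated.gen_pow, mul_zero, zero_mul])
  have hbt : bar t = w - 1 := by
    change aeval (w - 1) X = w - 1
    rw [aeval_X]
  have hb1 : (1 + t) * (1 + bar t) = 1 := by rw [hbt]; linear_combination hvi
  refine ⟨bar, hb1, fun r => ?_⟩
  have hbb : bar (bar t) = t := by
    have h2 := congrArg bar hb1
    rw [map_mul, map_add, map_add, map_one] at h2
    have h3 : 1 + bar (bar t) = 1 + t := by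
      linear_combination (1 + t) * h2 - (1 + bar (bar t)) * hb1
    exact add_left_cancel h3
  obtain ⟨f, rfl⟩ := Truncated.aeval_gen_surjective n r
  rw [← aeval_algHom_apply, ← aeval_algHom_apply, hbb]

variable [CharP k 2]

/-- The cyclic case: pulled back to a truncated polynomial algebra, an invariant alternating form
is the antisymmetrization of an invariant form. -/
theorem exists_invariant_sub_flip_truncated {ω : LinearMap.BilinForm k V} (hω : ω.IsAlt)
    {N : Module.End k V} (hu : InvariantUnder ω (1 + N))
    (hN : ∀ d x, (N ^ (d + 1)) x = 0 → ω x ((N ^ d) x) = 0)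
    (n : ℕ) (e : Truncated k n →ₗ[k] V) (he : ∀ r, e (Truncated.gen k n * r) = N (e r)) :
    ∃ β : LinearMap.BilinForm k (Truncated k n),
      (∀ r s, β ((1 + Truncated.gen k n) * r) ((1 + Truncated.gen k n) * s) = β r s) ∧
      ∀ r s, β r s - β s r = ω (e r) (e s) := by
  obtain ⟨bar, hbar, hbb⟩ := Truncated.exists_involution (k := k) n
  set t := Truncated.gen k n with ht
  have hepow : ∀ (m : ℕ) r, e (t ^ m * r) = (N ^ m) (e r) := by
    intro m
    induction m with
    | zero => simp
    | succ m ih => intro r; rw [pow_succ', mul_assoc, he, ih, pow_succ', Module.End.mul_apply]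
  have heu : ∀ r, e ((1 + t) * r) = (1 + N) (e r) := by
    intro r
    rw [add_mul, one_mul, map_add, he]
    rfl
  -- Invariance makes `bar` the adjoint of multiplication on the cyclic module. The set `S` where
  -- this holds contains `1` and is stable under `1 + t`, so it is everything.
  let S : Submodule k (Truncated k n) :=
    { carrier := {r | ∀ s, ω (e r) (e s) = ω (e 1) (e (bar r * s))}
      zero_mem' := by intro s; simp
      add_mem' := by
        intro a b ha hb s
        rw [map_add, map_add, LinearMap.add_apply, ha, hb, map_add, add_mul, map_add, map_add]
      smul_mem' := by
        intro c a ha s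
        rw [map_smul, map_smul, LinearMap.smul_apply, ha, map_smul, smul_mul_assoc, map_smul,
          map_smul] }
  have hSu : ∀ r ∈ S, (1 + t) * r ∈ S := by
    intro r hr s
    have hs : s = (1 + t) * ((1 + bar t) * s) := by linear_combination (-s) * hbar
    conv_lhs => rw [hs, heu, heu, hu, hr]
    rw [map_mul bar, map_add bar, map_one bar]
    congr 2
    ring
  have hS : ∀ r, r ∈ S := by
    intro r
    obtain ⟨f, rfl⟩ := Truncated.aeval_gen_surjective n r
    induction f using Polynomial.induction_on with
    | C a =>
      rw [aeval_C, Algebra.algebraMap_eq_smul_one]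
      exact S.smul_mem _ fun s => by rw [map_one bar, one_mul]
    | add f g hf hg => rw [map_add]; exact S.add_mem hf hg
    | monomial m a hf =>
      have := S.sub_mem (hSu _ hf) hf
      rw [add_mul, one_mul, add_sub_cancel_left, mul_comm, map_mul, map_pow, aeval_X, mul_assoc,
        ← pow_succ] at this
      rwa [map_mul, map_pow, aeval_X]
  let ν : Module.Dual k (Truncated k n) := (ω (e 1)) ∘ₗ e
  have hν : ∀ r, ν (bar r) = -ν r := by
    intro r
    have := hS r 1
    rw [mul_one] at this
    change ω (e 1) (e (bar r)) = -ω (e 1) (e r)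
    rw [← this, hω.neg_eq]
  obtain ⟨μ, hμ⟩ : ∃ μ : Module.Dual k (Truncated k n), ∀ r, μ r - μ (bar r) = ν r := by
    cases n with
    | zero =>
      have h0 : ∀ r : Truncated k 0, r = 0 := fun r => by
        have := Truncated.gen_pow (k := k) 0
        rw [pow_zero] at this
        rw [← mul_one r, this, mul_zero]
      exact ⟨0, fun r => by rw [h0 (r : Truncated k 0)]; simp⟩
    | succ d =>
      refine exists_sub_comp_eq (Truncated.aeval_gen_surjective _)
        (Truncated.exists_smul_of_gen_mul_eq_zero d) bar hbar (hbb _) ν hν (hω _) ?_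
      change ω (e 1) (e (t ^ d)) = 0
      rw [← mul_one (t ^ d), hepow]
      refine hN _ _ ?_
      rw [← hepow, ht, Truncated.gen_pow, zero_mul, map_zero]
  -- The form `μ (bar r * s)` is invariant because `(1 + t) * bar (1 + t) = 1`; flipping it replaces
  -- `μ` by `μ ∘ bar`.
  refine ⟨LinearMap.mk₂ k (fun r s => μ (bar r * s)) ?_ ?_ ?_ ?_, ?_, ?_⟩
  · intro a b s; simp [add_mul]
  · intro c a s; rw [map_smul, smul_mul_assoc, map_smul]
  · intro a s s'; simp [mul_add]
  · intro c a s; rw [mul_smul_comm, map_smul]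
  · intro r s
    simp only [LinearMap.mk₂_apply]
    congr 1
    rw [map_mul, map_add, map_one]
    linear_combination (bar r * s) * hbar
  · intro r s
    simp only [LinearMap.mk₂_apply]
    rw [hS r s]
    change _ = ν (bar r * s)
    rw [← hμ, map_mul bar, hbb, mul_comm (bar s)]

/-- In characteristic two, if `ω` is alternating and `1 + N`-invariant, `N` is nilpotent and
`ω x (N ^ d x) = 0` whenever `N ^ (d + 1) x = 0`, then `ω` is the antisymmetrization of an invariant
bilinear form. -/
theorem exists_invariant_sub_flip [FiniteDimensional k V] {ω : LinearMap.BilinForm k V}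
    (hω : ω.IsAlt) {N : Module.End k V} (hnil : IsNilpotent N) (hu : InvariantUnder ω (1 + N))
    (hN : ∀ d x, (N ^ (d + 1)) x = 0 → ω x ((N ^ d) x) = 0) :
    ∃ β : LinearMap.BilinForm k V, InvariantUnder β (1 + N) ∧
      ∀ x y, β x y - β y x = ω x y := by
  have htors : Module.IsTorsion' (Module.AEval' N) (Submonoid.powers (X : k[X])) := by
    rw [Submodule.isTorsion'_powers_iff]
    obtain ⟨m, hm⟩ := hnil
    intro x
    refine ⟨m, (Module.AEval'.of N).symm.injective ?_⟩
    rw [Module.AEval.of_symm_smul, aeval_X_pow, hm, zero_smul, map_zero]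
  obtain ⟨d, n, ⟨φ⟩⟩ := Module.torsion_by_prime_power_decomposition irreducible_X htors
  let ψ : Module.AEval' N ≃ₗ[k[X]] (∀ i : Fin d, Truncated k (n i)) :=
    φ.trans (DirectSum.linearEquivFunOnFintype k[X] (Fin d) fun i => Truncated k (n i))
  have hXN : ∀ x : V, Module.AEval'.of N (N x) = (X : k[X]) • Module.AEval'.of N x :=
    fun x => (Module.AEval.X_smul_of N x).symm
  let c : ∀ i, V →ₗ[k] Truncated k (n i) := fun i =>
    ((LinearMap.proj i ∘ₗ ψ.toLinearMap).restrictScalars k) ∘ₗ (Module.AEval'.of N).toLinearMap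
  let e : ∀ i, Truncated k (n i) →ₗ[k] V := fun i =>
    (Module.AEval'.of N).symm.toLinearMap ∘ₗ
      ((ψ.symm.toLinearMap ∘ₗ LinearMap.single k[X] _ i).restrictScalars k)
  have hsmul : ∀ i (r : Truncated k (n i)), Truncated.gen k (n i) * r = (X : k[X]) • r := by
    intro i r
    obtain ⟨f, rfl⟩ := Ideal.Quotient.mkₐ_surjective k _ r
    rfl
  have hc : ∀ i x, c i (N x) = Truncated.gen k (n i) * c i x := by
    intro i x
    rw [hsmul]
    change ψ (Module.AEval'.of N (N x)) i = X • ψ (Module.AEval'.of N x) i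
    rw [hXN, map_smul]
    rfl
  have he : ∀ i r, e i (Truncated.gen k (n i) * r) = N (e i r) := by
    intro i r
    rw [hsmul]
    change (Module.AEval'.of N).symm (ψ.symm (LinearMap.single k[X] _ i (X • r))) = _
    rw [map_smul, map_smul]
    exact Module.AEval.of_symm_X_smul N _
  have hcu : ∀ i x, c i ((1 + N) x) = (1 + Truncated.gen k (n i)) * c i x := by
    intro i x
    rw [add_mul, one_mul, ← hc, ← map_add]
    rfl
  refine exists_invariant_sub_flip_of_sum (ι := Fin d) hω hu (fun i => e i ∘ₗ c i) ?_ ?_ ?_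
  · intro i x
    rw [LinearMap.comp_apply, hcu, add_mul, one_mul, map_add, he]
    rfl
  · intro x
    refine (Module.AEval'.of N).injective (ψ.injective ?_)
    rw [map_sum, map_sum]
    refine Eq.trans (Finset.sum_congr rfl fun i _ => ?_)
      (Finset.univ_sum_single (ψ (Module.AEval'.of N x)))
    change ψ (Module.AEval'.of N ((Module.AEval'.of N).symm (ψ.symm _))) = _
    rw [LinearEquiv.apply_symm_apply, LinearEquiv.apply_symm_apply]
    rfl
  · intro i
    obtain ⟨β, hβ, hβ'⟩ := exists_invariant_sub_flip_truncated hω hu hN (n i) (e i) (he i)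
    refine ⟨β.compl₁₂ (c i) (c i), fun x y => ?_, fun x y => ?_⟩
    · simp only [LinearMap.compl₁₂_apply, hcu, hβ]
    · simp only [LinearMap.compl₁₂_apply, hβ', LinearMap.comp_apply]

end Polarization

/-! ### The Cayley-type transform and its inversion -/

section Cayley

open Polynomial

variable {k V : Type*} [Field k] [AddCommGroup V] [Module k V]

theorem Filtration.mul_mem_endGE (F : Filtration k V) {i j : ℤ} {S T : Module.End k V}
    (hS : S ∈ F.endGE i) (hT : T ∈ F.endGE j) : S * T ∈ F.endGE (i + j) := by
  intro a x hx
  have := hS _ _ (hT a x hx)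
  rwa [add_assoc, add_comm j] at this

theorem Filtration.endGE_antitone (F : Filtration k V) : Antitone F.endGE :=
  fun _ _ hij _ hT a x hx => F.antitone (by omega) (hT a x hx)

theorem Filtration.exists_endGE_eq_bot (F : Filtration k V) :
    ∃ n : ℕ, ∀ T ∈ F.endGE n, T = 0 := by
  obtain ⟨a, ha⟩ := F.exists_eq_top
  obtain ⟨b, hb⟩ := F.exists_eq_bot
  refine ⟨(b - a).toNat, fun T hT => LinearMap.ext fun x => ?_⟩
  have h1 := F.antitone (show b ≤ a + ((b - a).toNat : ℤ) by omega)
    (hT a x (by rw [ha]; exact Submodule.mem_top))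
  rw [hb] at h1
  simpa using h1

/-- The approximations to the solution of `p = s X - q J p`, `q = - s X - q (1 - J) p`,
starting from `(s T, s T')`, as polynomials in `s`. -/
def cayleyIter (J X₀ T T' : Module.End k V) :
    ℕ → (Module.End k V)[X] × (Module.End k V)[X]
  | 0 => (C T * X, C T' * X)
  | n + 1 =>
    (C X₀ * X - (cayleyIter J X₀ T T' n).2 * C J * (cayleyIter J X₀ T T' n).1,
      -(C X₀ * X) - (cayleyIter J X₀ T T' n).2 * C (1 - J) * (cayleyIter J X₀ T T' n).1)

/-- If `J + J* = 1` with `J` commuting with `N`, then every `T` commuting with `N` and such that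
`1 + T` is symplectic and unipotent is joined to `0` by a polynomial curve of such elements. -/
theorem exists_curve_of_add_adjoint_eq_one {ω : LinearMap.BilinForm k V} (hω : ω.IsAlt)
    (F : Filtration k V) {N J : Module.End k V} (hJF : J ∈ F.endGE 0) (hJN : Commute J N)
    (hJ : ∀ x y, ω (J x) y = ω x ((1 - J) y)) {T : Module.End k V}
    (hT : T ∈ sympEndGE ω F 1) (hTN : Commute T N) :
    ∃ P : (Module.End k V)[X],
      (∀ s : k, evalScalar (Module.End k V) s P ∈ sympEndGE ω F 1 ∧
        Commute (evalScalar (Module.End k V) s P) N) ∧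
      evalScalar (Module.End k V) (0 : k) P = 0 ∧ evalScalar (Module.End k V) (1 : k) P = T := by
  obtain ⟨g, hg⟩ := hT.2.1.isUnit_one_add
  have hgT : (g : Module.End k V) - 1 = T := by rw [hg, add_sub_cancel_left]
  have hgG : g ∈ groupOne ω F := (mem_groupOne_iff ω F g).2 (by rwa [hgT])
  -- `T'` is the adjoint of `T`. Defined through the group inverse, it lies in `E_{≥ 1}` without any
  -- appeal to self-duality of the filtration.
  set T' : Module.End k V := ((g⁻¹ : (Module.End k V)ˣ) : Module.End k V) - 1 with hT'
  have hT'F : T' ∈ F.endGE 1 := ((groupOne ω F).inv_mem hgG).1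
  have hgN : Commute (g : Module.End k V) N := by
    rw [hg]; exact (Commute.one_left N).add_left hTN
  have hT'N : Commute T' N := hgN.units_inv_left.sub_left (Commute.one_left N)
  have hTT' : T + T' + T' * T = 0 := by
    have := Units.inv_mul g
    rw [← hgT, hT', sub_mul, mul_sub, this]
    noncomm_ring
  have hadj : ∀ x y, ω (T x) y = ω x (T' y) := by
    intro x y
    have h1 := hgG.2 x (((g⁻¹ : (Module.End k V)ˣ) : Module.End k V) y)
    rw [← Module.End.mul_apply, Units.mul_inv, Module.End.one_apply, hg] at h1
    simp only [hT', LinearMap.sub_apply, LinearMap.add_apply, Module.End.one_apply, map_add,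
      map_sub] at h1 ⊢
    linear_combination h1
  -- The Cayley-type transform of `T`. It is skew-adjoint because `J* = 1 - J` and `T + T' + T' T =
  -- 0`.
  set X₀ := T + T' * J * T with hX₀
  have hX₀' : -X₀ - T' * (1 - J) * T = T' := by
    have : -X₀ - T' * (1 - J) * T = T' - (T + T' + T' * T) := by rw [hX₀]; noncomm_ring
    rw [this, hTT', sub_zero]
  have hX₀F : X₀ ∈ F.endGE 1 :=
    add_mem hT.1 (F.endGE_antitone (by norm_num)
      (F.mul_mem_endGE (F.mul_mem_endGE hT'F hJF) hT.1))
  have hX₀N : Commute X₀ N := hTN.add_left ((hT'N.mul_left hJN).mul_left hTN)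
  have h1J : 1 - J ∈ F.endGE 0 :=
    sub_mem (fun a x hx => by simpa using hx) hJF
  have h1JN : Commute (1 - J) N := (Commute.one_left N).sub_left hJN
  have hX₀adj : ∀ x y, ω (X₀ x) y = -ω x (X₀ y) := by
    have hadj' : ∀ x y, ω (T' x) y = ω x (T y) := fun x y => by
      rw [← hω.neg_eq, ← hadj, hω.neg_eq]
    intro x y
    have : X₀ = -T' - T' * (1 - J) * T := by
      rw [← sub_eq_zero, hX₀, ← hTT']; noncomm_ring
    conv_rhs => rw [this]
    rw [hX₀]
    simp only [LinearMap.add_apply, LinearMap.sub_apply, LinearMap.neg_apply,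
      Module.End.mul_apply, map_add, map_sub, map_neg, hadj, hadj', hJ]
    ring
  let p : ℕ → k → Module.End k V := fun n s =>
    evalScalar (Module.End k V) s (cayleyIter J X₀ T T' n).1
  let q : ℕ → k → Module.End k V := fun n s =>
    evalScalar (Module.End k V) s (cayleyIter J X₀ T T' n).2
  have hscal : ∀ (A : Module.End k V) (s : k), evalScalar (Module.End k V) s (C A * X) = s • A :=
    fun A s => by
      rw [map_mul, evalScalar_C, evalScalar_X, ← Algebra.commutes, ← Algebra.smul_def]
  have hp0 : ∀ s, p 0 s = s • T := fun s => hscal T s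
  have hq0 : ∀ s, q 0 s = s • T' := fun s => hscal T' s
  have hps : ∀ n s, p (n + 1) s = s • X₀ - q n s * J * p n s := fun n s => by
    simp only [p, q, cayleyIter, map_sub, map_mul (evalScalar (Module.End k V) s) _ (C J),
      map_mul (evalScalar (Module.End k V) s) (_ * C J), hscal, evalScalar_C]
  have hqs : ∀ n s, q (n + 1) s = -(s • X₀) - q n s * (1 - J) * p n s := fun n s => by
    simp only [p, q, cayleyIter]
    rw [map_sub, map_neg, hscal, map_mul, map_mul, evalScalar_C]
  have hF : ∀ n s, p n s ∈ F.endGE 1 ∧ q n s ∈ F.endGE 1 := by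
    intro n s
    induction n with
    | zero =>
      rw [hp0, hq0]
      exact ⟨Submodule.smul_mem _ _ hT.1, Submodule.smul_mem _ _ hT'F⟩
    | succ n ih =>
      rw [hps, hqs]
      exact ⟨sub_mem (Submodule.smul_mem _ _ hX₀F) (F.endGE_antitone (by norm_num)
          (F.mul_mem_endGE (F.mul_mem_endGE ih.2 hJF) ih.1)),
        sub_mem (neg_mem (Submodule.smul_mem _ _ hX₀F)) (F.endGE_antitone (by norm_num)
          (F.mul_mem_endGE (F.mul_mem_endGE ih.2 h1J) ih.1))⟩
  have hcomm : ∀ n s, Commute (p n s) N ∧ Commute (q n s) N := by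
    intro n s
    induction n with
    | zero =>
      rw [hp0, hq0]
      exact ⟨hTN.smul_left s, hT'N.smul_left s⟩
    | succ n ih =>
      rw [hps, hqs]
      exact ⟨(hX₀N.smul_left s).sub_left ((ih.2.mul_left hJN).mul_left ih.1),
        (hX₀N.smul_left s).neg_left.sub_left ((ih.2.mul_left h1JN).mul_left ih.1)⟩
  -- The two components stay mutually adjoint throughout the iteration.
  have hpq : ∀ n s x y, ω (p n s x) y = ω x (q n s y) := by
    intro n s
    induction n with
    | zero =>
      intro x y
      rw [hp0, hq0, LinearMap.smul_apply, LinearMap.smul_apply, map_smul, map_smul,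
        LinearMap.smul_apply, hadj]
    | succ n ih =>
      intro x y
      have ih' : ∀ x y, ω (q n s x) y = ω x (p n s y) := fun x y => by
        rw [← hω.neg_eq, ← ih, hω.neg_eq]
      rw [hps, hqs]
      simp only [LinearMap.sub_apply, LinearMap.neg_apply, LinearMap.smul_apply,
        Module.End.mul_apply, map_sub, map_neg, map_smul, ih, ih', hJ, hX₀adj, smul_eq_mul]
      ring
  -- The iteration is a contraction: the quadratic terms contain a factor from `E_{≥ 1}`, so each
  -- step moves the error one degree deeper.
  have hdiff : ∀ (n : ℕ) s, p (n + 1) s - p n s ∈ F.endGE n ∧ q (n + 1) s - q n s ∈ F.endGE n := by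
    intro n s
    induction n with
    | zero =>
      exact ⟨F.endGE_antitone (by norm_num) (sub_mem (hF 1 s).1 (hF 0 s).1),
        F.endGE_antitone (by norm_num) (sub_mem (hF 1 s).2 (hF 0 s).2)⟩
    | succ n ih =>
      have key : ∀ K ∈ F.endGE 0, q (n + 1) s * K * p (n + 1) s - q n s * K * p n s ∈
          F.endGE ((n + 1 : ℕ) : ℤ) := by
        intro K hK
        have e : q (n + 1) s * K * p (n + 1) s - q n s * K * p n s =
            q (n + 1) s * K * (p (n + 1) s - p n s) + (q (n + 1) s - q n s) * K * p n s := by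
          noncomm_ring
        rw [e]
        exact add_mem
          (F.endGE_antitone (by push_cast; omega)
            (F.mul_mem_endGE (F.mul_mem_endGE (hF (n + 1) s).2 hK) ih.1))
          (F.endGE_antitone (by push_cast; omega)
            (F.mul_mem_endGE (F.mul_mem_endGE ih.2 hK) (hF n s).1))
      have hsub : ∀ {a b c d e : Module.End k V}, a = c - d → b = c - e → a - b = -(d - e) := by
        rintro _ _ c d e rfl rfl
        abel
      have h1 := neg_mem (key J hJF)
      have h2 := neg_mem (key (1 - J) h1J)
      constructor
      · rwa [hsub (hps (n + 1) s) (hps n s)]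
      · rwa [hsub (hqs (n + 1) s) (hqs n s)]
  -- Since `E_{≥ m} = 0`, the `m`-th iterate is an exact solution for every `s`.
  obtain ⟨m, hm⟩ := F.exists_endGE_eq_bot
  refine ⟨(cayleyIter J X₀ T T' m).1, fun s => ⟨⟨(hF m s).1,
    nilpotent_of_mem_endGE F (hF m s).1, fun x y => ?_⟩, (hcomm m s).1⟩, ?_, ?_⟩
  · change ω (p m s x) y + ω x (p m s y) + ω (p m s x) (p m s y) = 0
    have e1 : s • X₀ - q m s * J * p m s = p m s := by
      rw [← hps, ← sub_eq_zero]; exact hm _ (hdiff m s).1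
    have e2 : -(s • X₀) - q m s * (1 - J) * p m s = q m s := by
      rw [← hqs, ← sub_eq_zero]; exact hm _ (hdiff m s).2
    have e3 : q m s + p m s + q m s * p m s = 0 := by
      have : q m s + p m s = -(q m s * p m s) := by
        have hadd : ∀ {a b c d e : Module.End k V}, c - d = a → -c - e = b →
            b + a = -(d + e) := by
          rintro _ _ c d e rfl rfl
          abel
        rw [hadd e1 e2]
        noncomm_ring
      rw [this, neg_add_cancel]
    rw [hpq, hpq, ← map_add, ← map_add]
    have := LinearMap.congr_fun e3 y
    rw [LinearMap.add_apply, LinearMap.add_apply, Module.End.mul_apply] at this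
    rw [this, LinearMap.zero_apply, map_zero]
  · have h0 : ∀ n, p n 0 = 0 := by
      intro n
      induction n with
      | zero => rw [hp0, zero_smul]
      | succ n ih => rw [hps, ih, zero_smul, mul_zero, sub_zero]
    exact h0 m
  -- At `s = 1` the starting pair `(T, T')` is already a fixed point; this is why the iteration
  -- starts from `(s T, s T')`.
  · have h1 : ∀ n, p n 1 = T ∧ q n 1 = T' := by
      intro n
      induction n with
      | zero => exact ⟨by rw [hp0, one_smul], by rw [hq0, one_smul]⟩
      | succ n ih =>
        rw [hps, hqs, ih.1, ih.2, one_smul]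
        exact ⟨by rw [hX₀, add_sub_cancel_right], hX₀'⟩
    exact (h1 m).1

end Cayley

/-! ### Vanishing of the obstruction, the operator `J`, and the component group -/

section NilFiltration

variable {k V : Type*} [Field k] [AddCommGroup V] [Module k V]

/-- Whatever commutes with `N` preserves the filtration attached to `N`. -/
theorem mem_endGE_zero_of_commute {N J : Module.End k V} (hN : IsNilpotent N)
    (hJ : Commute J N) : J ∈ (nilFiltration N hN).endGE 0 := by
  intro a x hx
  rw [add_zero]
  suffices h : nilFiltrationGE N a ≤ (nilFiltrationGE N a).comap J from h hx
  refine iSup_le fun j => iSup_le fun hj => ?_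
  rintro _ ⟨y, hy, rfl⟩
  refine Submodule.mem_iSup_of_mem j (Submodule.mem_iSup_of_mem hj ⟨J y, ?_, ?_⟩)
  · rw [SetLike.mem_coe, LinearMap.mem_ker] at hy ⊢
    rw [← Module.End.mul_apply, ← (hJ.pow_right _).eq, Module.End.mul_apply, hy, map_zero]
  · rw [← Module.End.mul_apply, ← (hJ.pow_right _).eq, Module.End.mul_apply]

theorem invariantUnder_one_add {ω : LinearMap.BilinForm k V} {N : Module.End k V}
    (hN : N ∈ nilSymplectic ω) : InvariantUnder ω (1 + N) := by
  intro x y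
  have := hN.2 x y
  simp only [LinearMap.add_apply, Module.End.one_apply, map_add]
  linear_combination this

/-- Powers of `N` move across the form: `ω (N x) ((1 + N) y') = -ω x (N y')`. Writing `y = (1 + N)
y'` costs nothing, since `y'` is still killed by `N ^ d`. -/
theorem form_pow_apply_pow_eq_zero {ω : LinearMap.BilinForm k V} {N : Module.End k V}
    (hN : N ∈ nilSymplectic ω) {d : ℕ} (i j : ℕ) (x y : V) (hy : (N ^ d) y = 0)
    (hij : d ≤ i + j) : ω ((N ^ i) x) ((N ^ j) y) = 0 := by
  induction i generalizing j y with
  | zero =>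
    rw [zero_add] at hij
    obtain ⟨c, rfl⟩ := Nat.exists_eq_add_of_le hij
    rw [add_comm, pow_add, Module.End.mul_apply (N ^ c), hy, map_zero, map_zero]
  | succ i ih =>
    obtain ⟨g, hg⟩ := hN.1.isUnit_one_add
    have hgN : Commute (g : Module.End k V) N := by
      rw [hg]; exact (Commute.one_left N).add_left (Commute.refl N)
    set y' := ((g⁻¹ : (Module.End k V)ˣ) : Module.End k V) y with hy'
    have hyy' : y = y' + N y' := by
      have : (g : Module.End k V) y' = y := by
        rw [hy', ← Module.End.mul_apply, Units.mul_inv, Module.End.one_apply]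
      rw [← this, hg]
      rfl
    have hdy' : (N ^ d) y' = 0 := by
      rw [hy', ← Module.End.mul_apply, ← (hgN.units_inv_left.pow_right d).eq,
        Module.End.mul_apply, hy, map_zero]
    have h1 := hN.2 ((N ^ i) x) ((N ^ j) y')
    have h2 := ih (j + 1) y' hdy' (by omega)
    rw [pow_succ', Module.End.mul_apply] at h2
    rw [hyy', pow_succ', Module.End.mul_apply, map_add, map_add, ← Module.End.mul_apply (N ^ j) N,
      ← pow_succ, pow_succ', Module.End.mul_apply]
    linear_combination h1 - h2

/-- Moving one `N` across changes the sign and leaves an error of total exponent `d + 1`, which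
vanishes by `form_pow_apply_pow_eq_zero`. -/
theorem form_apply_pow_eq_zero_of_form_pow_apply_pow {ω : LinearMap.BilinForm k V}
    {N : Module.End k V} (hN : N ∈ nilSymplectic ω) {d : ℕ} {x : V} (hx : (N ^ (d + 1)) x = 0)
    (i j : ℕ) (hij : i + j = d) (h : ω ((N ^ i) x) ((N ^ j) x) = 0) :
    ω x ((N ^ d) x) = 0 := by
  induction i generalizing j with
  | zero => simpa [← hij] using h
  | succ i ih =>
    refine ih (j + 1) (by omega) ?_
    have h1 := hN.2 ((N ^ i) x) ((N ^ j) x)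
    have h2 := form_pow_apply_pow_eq_zero hN (i + 1) (j + 1) x x hx (by omega)
    simp only [pow_succ' N i, pow_succ' N j, Module.End.mul_apply] at h h2 ⊢
    linear_combination h1 - h - h2

theorem form_apply_pow_eq_zero {ω : LinearMap.BilinForm k V} (hω : ω.IsAlt)
    {N : Module.End k V} (hN : N ∈ nilSymplectic ω)
    (h : ∀ x ∈ nilFiltrationGE N (-1), ω x (N x) = 0) (d : ℕ) (x : V)
    (hx : (N ^ (d + 1)) x = 0) : ω x ((N ^ d) x) = 0 := by
  -- The powers are split evenly. For `d = 2j`, alternation applies to `N ^ j x`; for `d = 2j + 1`,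
  -- the vector `N ^ j x` lies in `V_{≥ -1}` because `x` is in the kernel of `N ^ (2j + 2)`.
  obtain ⟨j, rfl | rfl⟩ := d.even_or_odd'
  · exact form_apply_pow_eq_zero_of_form_pow_apply_pow hN hx j j (by omega) (hω _)
  · refine form_apply_pow_eq_zero_of_form_pow_apply_pow hN hx j (j + 1) (by omega) ?_
    rw [pow_succ', Module.End.mul_apply]
    refine h _ (Submodule.mem_iSup_of_mem j (Submodule.mem_iSup_of_mem (by omega) ⟨x, ?_, rfl⟩))
    rw [SetLike.mem_coe, LinearMap.mem_ker,
      show (2 * (j : ℤ) - -1 + 1).toNat = 2 * j + 1 + 1 by omega, hx]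

/-- The operator `J` in the centralizer of `N` with `J + J* = 1`. -/
theorem exists_commute_add_adjoint_eq_one [CharP k 2] [FiniteDimensional k V]
    {ω : LinearMap.BilinForm k V} (hω : ω.IsAlt) (hnd : ω.Nondegenerate) {N : Module.End k V}
    (hN : N ∈ nilSymplectic ω) (h : ∀ x ∈ nilFiltrationGE N (-1), ω x (N x) = 0) :
    ∃ J : Module.End k V, Commute J N ∧ ∀ x y, ω (J x) y = ω x ((1 - J) y) := by
  have hu := invariantUnder_one_add hN
  obtain ⟨β, hβ, hβω⟩ :=
    exists_invariant_sub_flip hω hN.1 hu (form_apply_pow_eq_zero hω hN h)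
  -- `J` represents `β` through `ω`: invariance of `β` means that `J` commutes with `1 + N`, and the
  -- antisymmetrization identity is `J + J* = 1`.
  let J : Module.End k V := (ω.toDual hnd).symm.toLinearMap ∘ₗ β
  have hJ : ∀ x y, ω (J x) y = β x y := fun x y =>
    LinearMap.BilinForm.apply_toDual_symm_apply (hB := hnd) (β x) y
  obtain ⟨g, hg⟩ := hN.1.isUnit_one_add
  have hJu : Commute J (1 + N) := by
    refine LinearMap.ext fun x => (ω.toDual hnd).injective (LinearMap.ext fun y => ?_)
    have hy : y = (1 + N) (((g⁻¹ : (Module.End k V)ˣ) : Module.End k V) y) := by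
      rw [← hg, ← Module.End.mul_apply, Units.mul_inv, Module.End.one_apply]
    rw [LinearMap.BilinForm.toDual_def, LinearMap.BilinForm.toDual_def, Module.End.mul_apply,
      Module.End.mul_apply, hJ, hy, hβ, hu, hJ]
  refine ⟨J, ?_, fun x y => ?_⟩
  · simpa using hJu.sub_right (Commute.one_right J)
  · have h1 := hβω x y
    have h2 := hω.neg_eq (J y) x
    rw [hJ] at h2
    rw [LinearMap.sub_apply, Module.End.one_apply, map_sub, hJ, ← h2]
    linear_combination h1

/-- If all of a subgroup of `GL(V)` is connected, its component group is trivial. -/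
theorem subsingleton_quotient_identityComponent (H : Subgroup (Module.End k V)ˣ)
    (h : ZariskiConnected k ((fun g : (Module.End k V)ˣ => (g : Module.End k V)) '' H)) :
    Subsingleton (H ⧸ identityComponent H) := by
  have htop : identityComponent H = ⊤ := by
    refine top_le_iff.1 fun g _ => ?_
    let _ := zariski k (Module.End k V)
    let _ := subgroupZariski H
    have hind : Topology.IsInducing
        (fun h : H => ((h : (Module.End k V)ˣ) : Module.End k V)) := ⟨rfl⟩
    have hpre : IsPreconnected (Set.univ : Set H) := by
      rw [← hind.isPreconnected_image, Set.image_univ]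
      convert h.isPreconnected using 1
      ext T
      simp
    exact hpre.subset_connectedComponent (Set.mem_univ 1) (Set.mem_univ g)
  rw [htop]
  exact QuotientGroup.subsingleton_quotient_top

theorem image_centralizerIn_groupOne (ω : LinearMap.BilinForm k V) (F : Filtration k V)
    (N : Module.End k V) (u : (Module.End k V)ˣ) (hu : (u : Module.End k V) = 1 + N) :
    (fun g : (Module.End k V)ˣ => (g : Module.End k V)) '' (centralizerIn (groupOne ω F) u) =
      {g | g - 1 ∈ sympEndGE ω F 1 ∧ (g - 1) * N = N * (g - 1)} := by
  have hcomm : ∀ g : Module.End k V, Commute g (1 + N) ↔ (g - 1) * N = N * (g - 1) := fun g => by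
    rw [commute_iff_eq, ← sub_eq_zero, ← sub_eq_zero (a := (g - 1) * N)]
    refine iff_of_eq (congrArg (· = 0) ?_)
    noncomm_ring
  ext g
  constructor
  · rintro ⟨g, ⟨h1, h2⟩, rfl⟩
    refine ⟨(mem_groupOne_iff ω F g).1 h1, (hcomm _).1 ?_⟩
    rw [← hu]
    rw [commute_iff_eq, ← Units.val_mul, ← Units.val_mul,
      Subgroup.mem_centralizer_singleton_iff.1 h2]
  · rintro ⟨h1, h2⟩
    obtain ⟨v, hv⟩ : IsUnit g := by simpa using h1.2.1.isUnit_one_add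
    subst hv
    refine ⟨v, ⟨(mem_groupOne_iff ω F v).2 h1, Subgroup.mem_centralizer_singleton_iff.2 ?_⟩, rfl⟩
    refine Units.ext ?_
    rw [Units.val_mul, Units.val_mul, hu]
    exact (hcomm _).2 h2

end NilFiltration

end SympUnip

end

/-! ### The main theorem -/

open SympUnip in
theorem mainTheorem8 {k V : Type*} [Field k] [IsAlgClosed k] [CharP k 2]
    [AddCommGroup V] [Module k V] [FiniteDimensional k V]
    (ω : LinearMap.BilinForm k V) (hω : ω.IsAlt) (hnd : ω.Nondegenerate)
    (N : Module.End k V) (hN : N ∈ SympUnip.nilSymplectic ω)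
    (h : ∀ x ∈ (SympUnip.nilFiltration N hN.1).ge (-1), ω x (N x) = 0) :
    SympUnip.ZariskiConnected k
        {g : Module.End k V |
          g ∈ SympUnip.sympEndGE ω (SympUnip.nilFiltration N hN.1) 1 ∧ g * N = N * g} ∧
      Subsingleton
        (SympUnip.AOne ω (SympUnip.oneAdd ω hN) (SympUnip.isNilpotent_oneAdd_sub_one ω hN)) := by
  have : Infinite k := IsAlgClosed.instInfinite
  obtain ⟨J, hJN, hJ⟩ := exists_commute_add_adjoint_eq_one hω hnd hN h
  have hJF := mem_endGE_zero_of_commute hN.1 hJN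
  have hzero : (0 : Module.End k V) ∈ sympEndGE ω (nilFiltration N hN.1) 1 :=
    ⟨Submodule.zero_mem _, IsNilpotent.zero, by simp⟩
  constructor
  · refine zariskiConnected_of_curves (x := 0) ⟨hzero, by simp⟩ fun T hT => ?_
    exact exists_curve_of_add_adjoint_eq_one hω _ hJF hJN hJ hT.1 hT.2
  -- The filtration in `AOne` is attached to `(1 + N) - 1`, whose nilpotency proof depends on it;
  -- the equality with `N` is transported by substitution.
  · have hfil : ∀ (N' : Module.End k V) (h' : IsNilpotent N'), N' = N →
        nilFiltration N' h' = nilFiltration N hN.1 := by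
      rintro _ _ rfl
      rfl
    refine subsingleton_quotient_identityComponent _ ?_
    rw [image_centralizerIn_groupOne ω _ N _ (coe_oneAdd ω hN), hfil _ _ (by
      rw [coe_oneAdd, add_sub_cancel_left])]
    refine zariskiConnected_of_curves (x := 1) ⟨by simpa using hzero, by simp⟩ fun g hg => ?_
    obtain ⟨P, hP, h0, h1⟩ :=
      exists_curve_of_add_adjoint_eq_one hω _ hJF hJN hJ hg.1 hg.2
    -- The centralizer in `G₁` is the translate by `1` of the set already treated, so the curves are
    -- translated too.
    refine ⟨1 + P, fun s => ?_, ?_, ?_⟩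
    · rw [map_add, map_one, Set.mem_ofPred_eq, add_sub_cancel_left]
      exact hP s
    · rw [map_add, map_one, h0, add_zero]
    · rw [map_add, map_one, h1, add_sub_cancel]
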